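/- For every real $p\ge 1$ there are constants $\varepsilon_0,C,c>0$ depending only on $p$ such that the following holds for all $0<\varepsilon\le\varepsilon_0$ and all integers $d\ge 1$ and $n\ge C\,d\max\{1,\log d\}/\varepsilon^2$. Let $\mathsf{Lip}_1$ be the set of functions $f:\mathbb{R}\to\mathbb{R}$ with $f(0)=0$ and $|f(x)-f(y)|\le|x-y|$ for all $x,y$, and apply $f$ to vectors entrywise. For $A\in\mathbb{R}^{n\times d}$, $f\in\mathsf{Lip}_1$ and $b\in\mathbb{R}^n$ put $\mathsf{OPT}=\min_{x\in\mathbb{R}^d}\|f(Ax)-b\|_p^p$, and let $x^*$ be a minimizer with the smallest $\|Ax^*\|_p$ among all minimizers. Consider any randomized (adaptive) algorithm that is given $A$ and $f$ and can query the entries of the unknown vector $b$, and that, for all $A\in\mathbb{R}^{n\times d}$, $f\in\mathsf{Lip}_1$ and $b\in\mathbb{R}^n$ for which the minimum is attained, outputs with probability at least $4/5$ a vector $\hat x\in\mathbb{R}^d$ such that $$\|f(A\hat x)-b\|_p^p\le \mathsf{OPT}+\varepsilon\big(\mathsf{OPT}+\|Ax^*\|_p^p\big).$$ If, for all such $A$,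 all $f\in\mathsf{Lip}_1$ and all $b$, the algorithm almost surely makes at most $q$ queries to the entries of $b$, then $q\ge c\,d/\varepsilon^2$. That is, any such algorithm must make $\Omega(d/\varepsilon^2)$ queries. -/

import Mathlib

open MeasureTheory

universe u

/-- `Lip L`: the `L`-Lipschitz functions `f : ℝ → ℝ` with `f 0 = 0`. -/
def Lip (L : ℝ) : Set (ℝ → ℝ) :=
  {f | f 0 = 0 ∧ ∀ x y : ℝ, |f x - f y| ≤ L * |x - y|}

/-- `‖v‖_p ^ p = ∑ i, |v i| ^ p`, the `p`-th power of the `ℓ_p` norm on `ℝ ^ n`. -/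
noncomputable def lpPow {n : ℕ} (p : ℝ) (v : Fin n → ℝ) : ℝ :=
  ∑ i, |v i| ^ p

/-- The regression objective `‖f(Ax) - b‖_p ^ p`, with `f` applied entrywise. -/
noncomputable def loss {n d : ℕ} (p : ℝ) (A : Matrix (Fin n) (Fin d) ℝ) (f : ℝ → ℝ)
    (b : Fin n → ℝ) (x : Fin d → ℝ) : ℝ :=
  lpPow p (fun i => f (A.mulVec x i) - b i)

/-- `x` attains `OPT = min_y ‖f(Ay) - b‖_p ^ p`. -/
def IsMinimizer {n d : ℕ} (p : ℝ) (A : Matrix (Fin n) (Fin d) ℝ) (f : ℝ → ℝ)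
    (b : Fin n → ℝ) (x : Fin d → ℝ) : Prop :=
  ∀ y : Fin d → ℝ, loss p A f b x ≤ loss p A f b y

/-- `x` is an admissible choice of `x*`: a minimizer of the objective which, among all
minimizers, has the smallest `‖Ax‖_p ^ p`. -/
def IsMinNormMinimizer {n d : ℕ} (p : ℝ) (A : Matrix (Fin n) (Fin d) ℝ) (f : ℝ → ℝ)
    (b : Fin n → ℝ) (x : Fin d → ℝ) : Prop :=
  IsMinimizer p A f b x ∧
    ∀ y : Fin d → ℝ, IsMinimizer p A f b y → lpPow p (A.mulVec x) ≤ lpPow p (A.mulVec y)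

/-- The error guarantee `‖f(A x̂) - b‖_p ^ p ≤ OPT + ε (OPT + L ^ p ‖A x*‖_p ^ p)`.
Here `OPT` is the objective at `x*`; the right-hand side is the same for all choices of `x*`.
If the objective has no minimizer, `OPT` and `x*` do not exist and nothing is required. -/
def ErrorGuarantee {n d : ℕ} (p L ε : ℝ) (A : Matrix (Fin n) (Fin d) ℝ) (f : ℝ → ℝ)
    (b : Fin n → ℝ) (xhat : Fin d → ℝ) : Prop :=
  ∀ xstar : Fin d → ℝ, IsMinNormMinimizer p A f b xstar →
    loss p A f b xhat ≤
      loss p A f b xstar + ε * (loss p A f b xstar + L ^ p * lpPow p (A.mulVec xstar))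

/-- A deterministic adaptive algorithm with query access to the entries of a vector in `ℝ ^ n`
and with output in `ℝ ^ d`: it either stops with an output, or queries an entry and
continues in a way that depends on the value it has read. -/
inductive QueryTree (n d : ℕ) : Type
  | output (x : Fin d → ℝ) : QueryTree n d
  | query (i : Fin n) (next : ℝ → QueryTree n d) : QueryTree n d

/-- The output of the algorithm when the queries are answered by `b`. -/
def QueryTree.eval {n d : ℕ} (b : Fin n → ℝ) : QueryTree n d → (Fin d → ℝ)
  | .output x => x
  | .query i next => (next (b i)).eval b

/-- The number of queries the algorithm makes when they are answered by `b`. -/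
def QueryTree.numQueries {n d : ℕ} (b : Fin n → ℝ) : QueryTree n d → ℕ
  | .output _ => 0
  | .query i next => (next (b i)).numQueries b + 1

/-- A randomized algorithm which is given `A` and `f` and has query access to `b`: a random
seed `ω`, together with `A` and `f`, determines an adaptive query algorithm. For every input,
the output is a random vector. The seed space is an arbitrary probability space. -/
structure RandomizedAlgorithm (n d : ℕ) where
  Ω : Type u
  [measurableSpace : MeasurableSpace Ω]
  P : Measure Ω
  [isProbabilityMeasure : IsProbabilityMeasure P]
  tree : Matrix (Fin n) (Fin d) ℝ → (ℝ → ℝ) → Ω → QueryTree n d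
  measurable_eval : ∀ (A : Matrix (Fin n) (Fin d) ℝ) (f : ℝ → ℝ) (b : Fin n → ℝ),
    Measurable fun ω => (tree A f ω).eval b

attribute [instance] RandomizedAlgorithm.measurableSpace
  RandomizedAlgorithm.isProbabilityMeasure

/-- On every input `A`, `f ∈ Lip 1`, `b`, the output satisfies the error guarantee (with `L = 1`)
with probability at least `4/5`. -/
def RandomizedAlgorithm.Succeeds {n d : ℕ} (𝒜 : RandomizedAlgorithm n d) (p ε : ℝ) : Prop :=
  ∀ (A : Matrix (Fin n) (Fin d) ℝ), ∀ f ∈ Lip 1, ∀ b : Fin n → ℝ,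
    4 / 5 ≤ 𝒜.P {ω | ErrorGuarantee p 1 ε A f b ((𝒜.tree A f ω).eval b)}

/-- On every input `A`, `f ∈ Lip 1`, `b`, the algorithm almost surely makes at most `q`
queries to the entries of `b`. -/
def RandomizedAlgorithm.MakesAtMost {n d : ℕ} (𝒜 : RandomizedAlgorithm n d) (q : ℕ) : Prop :=
  ∀ (A : Matrix (Fin n) (Fin d) ℝ), ∀ f ∈ Lip 1, ∀ b : Fin n → ℝ,
    ∀ᵐ ω ∂𝒜.P, (𝒜.tree A f ω).numQueries b ≤ q

/-! The hard instance has `m = 64 * r ^ 2` hidden bits per coordinate, with `r` of order `1/ε`. Each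
bit is stored in a pair of rows `±e_j` with responses `1, 0` or `0, 1`, and `f` is `ramp`. Moving `x
j` to the point of opposite sign with complementary `ramp` value changes the loss by exactly ± the
block sum (`pairLoss_rampFlip`), so a wrong sign costs `|blockSum|`, typically of order `r`. The
allowed error is `O(ε d m) = O(ε r · d r)` with `ε r ≤ 1/4000`, so a good output has the sign of the
block sum on nearly all of the mass.

A query algorithm cannot find these signs cheaply. Given the bits read so far, the unread part of a
block is symmetric, so the sign correlates with an odd Lipschitz function of the block sum only
through the known part; the sum of squares of the known parts grows by one on average per new bit
(`QueryTree.sum_subcube_corr_le`). Anticoncentration (`le_sum_abs_truncate_blockSum`) shows that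
success needs correlation of order `d`, hence `q` of order `d r ^ 2`. Randomized algorithms reduce
to deterministic ones by averaging over the bits. -/

/-! ### Correlation bound for query algorithms -/

/-- The sign `±1` encoded by a bit. -/
def boolSign (a : Bool) : ℝ := cond a 1 (-1)

theorem boolSign_not (a : Bool) : boolSign (!a) = -boolSign a := by
  cases a <;> simp [boolSign]

theorem boolSign_sq (a : Bool) : boolSign a ^ 2 = 1 := by
  cases a <;> simp [boolSign]

/-- The sum of the signs of the bits of `t` with index in `U` and in block `j`. -/
noncomputable def blockSum {ι J : Type*} [DecidableEq J] (blk : ι → J) (U : Finset ι)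
    (t : ι → Bool) (j : J) : ℝ :=
  ∑ i ∈ U with blk i = j, boolSign (t i)

/-- Over a subcube on which the coordinates in `U` are known, an odd `K`-Lipschitz function of a
block sum correlates with a constant sign only as far as the known part of the sum does. -/
theorem sum_subcube_const_corr_le {ι J : Type*} [Fintype ι] [DecidableEq ι] [DecidableEq J]
    (blk : ι → J) {φ : ℝ → ℝ} (hodd : ∀ x, φ (-x) = -φ x)
    {K μ : ℝ} (hμ : 0 < μ) (hK : ∀ x y, |φ x - φ y| ≤ K * |x - y|) {s : ℝ} (hs : |s| ≤ 1)
    (U : Finset ι) (Q : Finset (ι → Bool))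
    (hclosed : ∀ t ∈ Q, ∀ t' : ι → Bool, (∀ i ∈ U, t' i = t i) → t' ∈ Q) (j : J) :
    ∑ t ∈ Q, s * φ (blockSum blk Finset.univ t j) ≤
      ∑ t ∈ Q, (K ^ 2 / (4 * μ) + μ * blockSum blk U t j ^ 2) := by
  -- Flipping the unread bits preserves `Q`, fixes the known part `S` of the block sum and negates
  -- the rest `R`. Averaging over `t` and `σ t` leaves `φ (S + R) - φ (R - S)` by oddness.
  set σ : (ι → Bool) → (ι → Bool) := fun t i => if i ∈ U then t i else !t i with hσ
  have hσσ : ∀ t, σ (σ t) = t := by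
    intro t; ext i; simp only [hσ]; split_ifs <;> simp
  have hσQ : ∀ t ∈ Q, σ t ∈ Q := fun t ht =>
    hclosed t ht _ fun i hi => by simp [hσ, hi]
  have hsplit : ∀ t, blockSum blk Finset.univ t j =
      blockSum blk U t j + blockSum blk Uᶜ t j := by
    intro t
    simp only [blockSum, Finset.sum_filter]
    rw [Finset.sum_add_sum_compl]
  have hU : ∀ t, blockSum blk U (σ t) j = blockSum blk U t j := by
    intro t
    refine Finset.sum_congr rfl fun i hi => ?_
    simp [hσ, (Finset.mem_filter.1 hi).1]
  have hUc : ∀ t, blockSum blk Uᶜ (σ t) j = -blockSum blk Uᶜ t j := by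
    intro t
    rw [blockSum, blockSum, ← Finset.sum_neg_distrib]
    refine Finset.sum_congr rfl fun i hi => ?_
    have : i ∉ U := by simpa using (Finset.mem_filter.1 hi).1
    simp [hσ, this, boolSign_not]
  have hflip : ∑ t ∈ Q, s * φ (blockSum blk Finset.univ (σ t) j) =
      ∑ t ∈ Q, s * φ (blockSum blk Finset.univ t j) :=
    Finset.sum_bij' (fun t _ => σ t) (fun t _ => σ t) hσQ hσQ (fun t _ => hσσ t)
      (fun t _ => hσσ t) (fun t _ => rfl)
  have hpt : ∀ t, s * φ (blockSum blk Finset.univ t j) +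
      s * φ (blockSum blk Finset.univ (σ t) j) ≤
      2 * (K ^ 2 / (4 * μ) + μ * blockSum blk U t j ^ 2) := by
    intro t
    rw [hsplit, hsplit, hU, hUc]
    set S := blockSum blk U t j
    set R := blockSum blk Uᶜ t j
    have h1 : φ (S + -R) = -φ (R - S) := by rw [← hodd]; congr 1; ring
    have h2 : |φ (S + R) - φ (R - S)| ≤ K * (2 * |S|) := by
      refine (hK _ _).trans_eq ?_
      rw [show S + R - (R - S) = 2 * S by ring, abs_mul, abs_two]
    have h3 : s * φ (S + R) + s * φ (S + -R) ≤ K * (2 * |S|) := by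
      rw [h1]
      calc s * φ (S + R) + s * -φ (R - S) = s * (φ (S + R) - φ (R - S)) := by ring
        _ ≤ |s| * |φ (S + R) - φ (R - S)| := by rw [← abs_mul]; exact le_abs_self _
        _ ≤ 1 * |φ (S + R) - φ (R - S)| := by gcongr
        _ ≤ _ := by rw [one_mul]; exact h2
    -- AM-GM, so that the bound involves the square `S ^ 2`, whose average can be tracked along the
    -- tree.
    have h4 : K * |S| ≤ K ^ 2 / (4 * μ) + μ * S ^ 2 := by
      rw [← sub_nonneg, ← sq_abs S]
      have : K ^ 2 / (4 * μ) + μ * |S| ^ 2 - K * |S| = (K - 2 * μ * |S|) ^ 2 / (4 * μ) := by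
        field_simp; ring
      rw [this]; positivity
    linarith
  have h := Finset.sum_le_sum fun t (_ : t ∈ Q) => hpt t
  rw [Finset.sum_add_distrib, hflip,
    ← Finset.mul_sum _ fun t => K ^ 2 / (4 * μ) + μ * blockSum blk U t j ^ 2] at h
  linarith

theorem blockSum_insert_sq {ι J : Type*} [DecidableEq ι] [Fintype J] [DecidableEq J]
    (blk : ι → J) {U : Finset ι} {k : ι} (hk : k ∉ U) (t : ι → Bool) :
    ∑ j, blockSum blk (insert k U) t j ^ 2 =
      ∑ j, blockSum blk U t j ^ 2 + 2 * (boolSign (t k) * blockSum blk U t (blk k)) + 1 := by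
  have h : ∀ j, blockSum blk (insert k U) t j ^ 2 = blockSum blk U t j ^ 2 +
      if blk k = j then 2 * (boolSign (t k) * blockSum blk U t (blk k)) + 1 else 0 := by
    intro j
    rw [blockSum, Finset.filter_insert]
    split_ifs with hj
    · subst hj
      rw [Finset.sum_insert (by simp [hk]), ← blockSum, add_sq, boolSign_sq]
      ring
    · simp [blockSum]
  rw [Finset.sum_congr rfl fun j _ => h j, Finset.sum_add_distrib, Finset.sum_ite_eq]
  simp [add_assoc]

/-- Flipping the unread bit `k` preserves `Q` and negates each term. This kills the cross term in
`blockSum_insert_sq`. -/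
theorem sum_subcube_boolSign_mul_blockSum {ι J : Type*} [DecidableEq ι] [DecidableEq J]
    (blk : ι → J) {U : Finset ι} {k : ι} (hk : k ∉ U)
    (Q : Finset (ι → Bool))
    (hclosed : ∀ t ∈ Q, ∀ t' : ι → Bool, (∀ i ∈ U, t' i = t i) → t' ∈ Q) (j : J) :
    ∑ t ∈ Q, boolSign (t k) * blockSum blk U t j = 0 := by
  set σ : (ι → Bool) → (ι → Bool) := fun t => Function.update t k (!t k) with hσ
  have hσσ : ∀ t, σ (σ t) = t := by intro t; simp [hσ]
  have hagree : ∀ t, ∀ i ∈ U, σ t i = t i := fun t i hi =>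
    Function.update_of_ne (by rintro rfl; exact hk hi) _ _
  have hσQ : ∀ t ∈ Q, σ t ∈ Q := fun t ht => hclosed t ht _ (hagree t)
  have hU : ∀ t, blockSum blk U (σ t) j = blockSum blk U t j := fun t =>
    Finset.sum_congr rfl fun i hi => by rw [hagree t i (Finset.mem_filter.1 hi).1]
  have hflip : ∑ t ∈ Q, boolSign (σ t k) * blockSum blk U (σ t) j =
      ∑ t ∈ Q, boolSign (t k) * blockSum blk U t j :=
    Finset.sum_bij' (fun t _ => σ t) (fun t _ => σ t) hσQ hσQ (fun t _ => hσσ t)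
      (fun t _ => hσσ t) (fun t _ => rfl)
  have hneg : ∀ t, boolSign (σ t k) * blockSum blk U (σ t) j =
      -(boolSign (t k) * blockSum blk U t j) := by
    intro t; rw [hU]; simp [hσ, boolSign_not]
  rw [Finset.sum_congr rfl fun t _ => hneg t, Finset.sum_neg_distrib] at hflip
  linarith

/-- The correlation of the output of a query algorithm with odd Lipschitz functions of the block
sums, over the subcube `Q` of inputs on which the bits in `U` are known. -/
theorem QueryTree.sum_subcube_corr_le {ι J : Type*} [Fintype ι] [DecidableEq ι] [Fintype J]
    [DecidableEq J]
    {n d : ℕ} (blk : ι → J) (κ : Fin n → ι)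
    (b : (ι → Bool) → Fin n → ℝ) (hb : ∀ i t t', t (κ i) = t' (κ i) → b t i = b t' i)
    {φ : ℝ → ℝ} (hodd : ∀ x, φ (-x) = -φ x) {K μ : ℝ} (hμ : 0 < μ)
    (hK : ∀ x y, |φ x - φ y| ≤ K * |x - y|)
    (s : (Fin d → ℝ) → J → ℝ) (hs : ∀ x j, |s x j| ≤ 1) (T : QueryTree n d) :
    ∀ (U : Finset ι) (Q : Finset (ι → Bool)), (∀ t ∈ Q, ∀ t' ∈ Q, ∀ i ∈ U, t' i = t i) →
      (∀ t ∈ Q, ∀ t' : ι → Bool, (∀ i ∈ U, t' i = t i) → t' ∈ Q) →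
      ∑ t ∈ Q, ∑ j, s (T.eval (b t)) j * φ (blockSum blk Finset.univ t j) ≤
        ∑ t ∈ Q, (Fintype.card J * (K ^ 2 / (4 * μ)) + μ * ∑ j, blockSum blk U t j ^ 2 +
          μ * T.numQueries (b t)) := by
  induction T with
  | output x =>
    intro U Q _ hclosed
    rw [Finset.sum_comm]
    refine (Finset.sum_le_sum fun j _ =>
      sum_subcube_const_corr_le blk hodd hμ hK (hs x j) U Q hclosed j).trans_eq ?_
    rw [Finset.sum_comm]
    refine Finset.sum_congr rfl fun t _ => ?_
    simp [QueryTree.numQueries, Finset.sum_add_distrib, Finset.mul_sum]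
  | query i next ih =>
    intro U Q hagree hclosed
    by_cases hk : κ i ∈ U
    -- A bit already read has a constant answer on `Q`: nothing is learnt and the bound only gains
    -- `μ`.
    · rcases Q.eq_empty_or_nonempty with rfl | ⟨t₀, ht₀⟩
      · simp
      have hbv : ∀ t ∈ Q, b t i = b t₀ i := fun t ht => hb i _ _ (hagree t₀ ht₀ t ht _ hk)
      refine le_trans (le_of_eq ?_) ((ih (b t₀ i) U Q hagree hclosed).trans ?_)
      · refine Finset.sum_congr rfl fun t ht => ?_
        rw [QueryTree.eval, hbv t ht]
      · refine Finset.sum_le_sum fun t ht => ?_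
        rw [QueryTree.numQueries, hbv t ht]
        push_cast
        linarith
    -- A new bit splits `Q` into two subcubes, each with a constant answer; the induction hypothesis
    -- applies to both with `κ i` added to `U`.
    · have hpart : ∀ c : Bool,
          ∑ t ∈ Q with t (κ i) = c, ∑ j, s ((QueryTree.query i next).eval (b t)) j *
            φ (blockSum blk Finset.univ t j) ≤
          ∑ t ∈ Q with t (κ i) = c, (Fintype.card J * (K ^ 2 / (4 * μ)) +
            μ * ∑ j, blockSum blk (insert (κ i) U) t j ^ 2 +
            μ * (next (b t i)).numQueries (b t)) := by
        intro c
        rcases (Q.filter fun t => t (κ i) = c).eq_empty_or_nonempty with he | ⟨t₀, ht₀⟩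
        · simp [he]
        have hbv : ∀ t ∈ Q.filter (fun t => t (κ i) = c), b t i = b t₀ i := fun t ht =>
          hb i _ _ ((Finset.mem_filter.1 ht).2.trans (Finset.mem_filter.1 ht₀).2.symm)
        refine le_trans (le_of_eq ?_) ((ih (b t₀ i) (insert (κ i) U)
          (Q.filter fun t => t (κ i) = c) ?_ ?_).trans (le_of_eq ?_))
        · refine Finset.sum_congr rfl fun t ht => ?_
          rw [QueryTree.eval, hbv t ht]
        · intro t ht t' ht' l hl
          rw [Finset.mem_filter] at ht ht'
          rcases Finset.mem_insert.1 hl with rfl | hl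
          · rw [ht.2, ht'.2]
          · exact hagree t ht.1 t' ht'.1 l hl
        · intro t ht t' h
          rw [Finset.mem_filter] at ht ⊢
          exact ⟨hclosed t ht.1 t' fun l hl => h l (Finset.mem_insert_of_mem hl),
            (h _ (Finset.mem_insert_self _ _)).trans ht.2⟩
        · refine Finset.sum_congr rfl fun t ht => ?_
          rw [hbv t ht]
      have hsum : ∀ g : (ι → Bool) → ℝ, ∑ t ∈ Q, g t =
          ∑ t ∈ Q with t (κ i) = true, g t + ∑ t ∈ Q with t (κ i) = false, g t := by
        intro g
        rw [← Finset.sum_filter_add_sum_filter_not Q (fun t => t (κ i) = true)]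
        simp
      rw [hsum]
      refine (add_le_add (hpart true) (hpart false)).trans ?_
      rw [← hsum, Finset.sum_congr rfl fun t _ => by rw [blockSum_insert_sq blk hk t]]
      have h0 := sum_subcube_boolSign_mul_blockSum blk hk Q hclosed (blk (κ i))
      have : ∀ t ∈ Q, (Fintype.card J * (K ^ 2 / (4 * μ)) +
          μ * (∑ j, blockSum blk U t j ^ 2 +
            2 * (boolSign (t (κ i)) * blockSum blk U t (blk (κ i))) + 1) +
          μ * (next (b t i)).numQueries (b t)) =
          (Fintype.card J * (K ^ 2 / (4 * μ)) + μ * ∑ j, blockSum blk U t j ^ 2 +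
            μ * (QueryTree.query i next).numQueries (b t)) +
          2 * μ * (boolSign (t (κ i)) * blockSum blk U t (blk (κ i))) := by
        intro t _
        rw [QueryTree.numQueries]
        push_cast
        ring
      rw [Finset.sum_congr rfl this, Finset.sum_add_distrib, ← Finset.mul_sum, h0]
      simp

/-- The correlation of the output of a query algorithm with odd Lipschitz functions of the block
sums, over uniformly random bits. -/
theorem QueryTree.sum_corr_le {ι J : Type*} [Fintype ι] [DecidableEq ι] [Fintype J] [DecidableEq J]
    {n d : ℕ} (blk : ι → J) (κ : Fin n → ι)
    (b : (ι → Bool) → Fin n → ℝ) (hb : ∀ i t t', t (κ i) = t' (κ i) → b t i = b t' i)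
    {φ : ℝ → ℝ} (hodd : ∀ x, φ (-x) = -φ x) {K μ : ℝ} (hμ : 0 < μ)
    (hK : ∀ x y, |φ x - φ y| ≤ K * |x - y|)
    (s : (Fin d → ℝ) → J → ℝ) (hs : ∀ x j, |s x j| ≤ 1) (T : QueryTree n d) :
    ∑ t, ∑ j, s (T.eval (b t)) j * φ (blockSum blk Finset.univ t j) ≤
      ∑ t, (Fintype.card J * (K ^ 2 / (4 * μ)) + μ * T.numQueries (b t)) := by
  simpa [blockSum] using
    T.sum_subcube_corr_le blk κ b hb hodd hμ hK s hs ∅ Finset.univ (by simp) (by simp)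

/-! ### Anticoncentration of block sums -/

/-- By induction from the recurrence for central binomials and `(2k+1)(2k+3) ≤ 4(k+1)²`. -/
theorem two_mul_add_one_mul_centralBinom_sq_le (k : ℕ) :
    (2 * k + 1) * k.centralBinom ^ 2 ≤ 16 ^ k := by
  induction k with
  | zero => simp
  | succ k ih =>
    refine Nat.le_of_mul_le_mul_left ?_ (show 0 < (k + 1) ^ 2 by positivity)
    calc (k + 1) ^ 2 * ((2 * (k + 1) + 1) * (k + 1).centralBinom ^ 2)
        = (2 * k + 3) * ((k + 1) * (k + 1).centralBinom) ^ 2 := by ring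
      _ = 4 * ((2 * k + 3) * (2 * k + 1)) * ((2 * k + 1) * k.centralBinom ^ 2) := by
        rw [Nat.succ_mul_centralBinom_succ]; ring
      _ ≤ 4 * (4 * (k + 1) ^ 2) * 16 ^ k :=
        Nat.mul_le_mul (Nat.mul_le_mul_left _ (by nlinarith)) ih
      _ = (k + 1) ^ 2 * 16 ^ (k + 1) := by ring

theorem eight_mul_centralBinom_le (r : ℕ) :
    8 * r * (32 * r ^ 2).centralBinom ≤ 2 ^ (64 * r ^ 2) := by
  refine (Nat.pow_le_pow_iff_left two_ne_zero).1 ?_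
  calc (8 * r * (32 * r ^ 2).centralBinom) ^ 2
      = 64 * r ^ 2 * (32 * r ^ 2).centralBinom ^ 2 := by ring
    _ ≤ (2 * (32 * r ^ 2) + 1) * (32 * r ^ 2).centralBinom ^ 2 := by gcongr; omega
    _ ≤ 16 ^ (32 * r ^ 2) := two_mul_add_one_mul_centralBinom_sq_le _
    _ = (2 ^ (64 * r ^ 2)) ^ 2 := by
      rw [show 16 = 2 ^ 4 by norm_num, ← pow_mul, ← pow_mul]; congr 1; ring

theorem sum_boolSign_eq {α : Type*} [Fintype α] (s : α → Bool) :
    ∑ k, boolSign (s k) = 2 * (Finset.univ.filter fun k => s k = true).card - Fintype.card α := by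
  have h : ∀ k, boolSign (s k) = 2 * (if s k = true then 1 else 0) - 1 := by
    intro k; cases s k <;> norm_num [boolSign]
  rw [Finset.sum_congr rfl fun k _ => h k, Finset.sum_sub_distrib, ← Finset.mul_sum]
  simp

theorem card_filter_card_eq_le {m : ℕ} (w : ℕ) :
    (Finset.univ.filter fun s : Fin m → Bool =>
      (Finset.univ.filter fun k => s k = true).card = w).card ≤ m.choose w := by
  have h : ((Finset.univ : Finset (Fin m)).powersetCard w).card = m.choose w := by simp
  rw [← h]
  refine Finset.card_le_card_of_injOn (fun s => Finset.univ.filter fun k => s k = true) ?_ ?_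
  · intro s hs
    simpa [Finset.mem_powersetCard] using hs
  · intro s _ s' _ h
    ext k
    have := congrArg (fun u => k ∈ u) h
    simpa [← Bool.eq_iff_iff] using this

/-- Anticoncentration of a Rademacher sum. -/
theorem card_abs_sum_boolSign_lt_le (r : ℕ) :
    4 * (Finset.univ.filter fun s : Fin (64 * r ^ 2) → Bool =>
      |∑ k, boolSign (s k)| < 2 * r).card ≤ 2 ^ (64 * r ^ 2) := by
  set m := 64 * r ^ 2 with hm
  -- A small sum leaves at most `2 * r` values for the number of true bits, each of probability at
  -- most `1 / (8 * r)`.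
  have hsub : (Finset.univ.filter fun s : Fin m → Bool => |∑ k, boolSign (s k)| < 2 * r) ⊆
      (Finset.Ico (32 * r ^ 2 - r) (32 * r ^ 2 + r)).biUnion fun w =>
        Finset.univ.filter fun s : Fin m → Bool =>
          (Finset.univ.filter fun k => s k = true).card = w := by
    intro s hs
    simp only [Finset.mem_filter, Finset.mem_univ, true_and, Finset.mem_biUnion,
      exists_eq_right', sum_boolSign_eq, Fintype.card_fin, abs_lt, hm] at hs ⊢
    set w := (Finset.univ.filter fun k => s k = true).card
    push_cast at hs
    have h1 : 32 * r ^ 2 < w + r := by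
      have : (32 * r ^ 2 : ℝ) < w + r := by linarith
      exact_mod_cast this
    have h2 : w < 32 * r ^ 2 + r := by
      have : (w : ℝ) < 32 * r ^ 2 + r := by linarith
      exact_mod_cast this
    rw [Finset.mem_Ico]
    omega
  have hle : (Finset.univ.filter fun s : Fin m → Bool => |∑ k, boolSign (s k)| < 2 * r).card ≤
      2 * r * (32 * r ^ 2).centralBinom := by
    refine (Finset.card_le_card hsub).trans ((Finset.card_biUnion_le_card_mul _ _ _ ?_).trans
      (Nat.mul_le_mul_right _ ?_))
    · intro w _
      refine (card_filter_card_eq_le w).trans ?_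
      rw [hm, show 64 * r ^ 2 = 2 * (32 * r ^ 2) by ring]
      exact Nat.choose_le_centralBinom _ _
    · rw [Nat.card_Ico]; omega
  calc _ ≤ 4 * (2 * r * (32 * r ^ 2).centralBinom) := by gcongr
    _ = 8 * r * (32 * r ^ 2).centralBinom := by ring
    _ ≤ _ := eight_mul_centralBinom_le r

/-- An event about one block has the same probability among all bits as among the bits of that
block. -/
theorem card_filter_marginal {J K : Type*} [Fintype J] [DecidableEq J] [Fintype K]
    [DecidableEq K] (P : (K → Bool) → Prop) [DecidablePred P] (j : J) :
    (Finset.univ.filter fun t : J × K → Bool => P fun k => t (j, k)).card *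
        2 ^ Fintype.card K =
      (Finset.univ.filter P).card * Fintype.card (J × K → Bool) := by
  have h1 : (Finset.univ.filter fun t : J × K → Bool => P fun k => t (j, k)).card =
      (Fintype.piFinset fun j' => if j' = j then Finset.univ.filter P else Finset.univ).card := by
    refine Finset.card_equiv (Equiv.curry J K Bool) fun t => ?_
    simp only [Finset.mem_filter, Finset.mem_univ, true_and, Fintype.mem_piFinset]
    constructor
    · intro h j'
      split_ifs with hj
      · subst hj; exact Finset.mem_filter.2 ⟨Finset.mem_univ _, h⟩
      · simp
    · intro h
      have hj := h j
      rw [if_pos rfl] at hj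
      exact (Finset.mem_filter.1 hj).2
  have h2 : Fintype.card (J × K → Bool) =
      2 ^ Fintype.card K * ∏ _j' ∈ Finset.univ.erase j, 2 ^ Fintype.card K := by
    rw [Finset.mul_prod_erase Finset.univ (fun _ : J => 2 ^ Fintype.card K) (Finset.mem_univ j)]
    simp [← pow_mul, mul_comm]
  rw [h1, h2, Fintype.card_piFinset, ← Finset.mul_prod_erase _ _ (Finset.mem_univ j), if_pos rfl,
    Finset.prod_congr rfl fun j' hj' => by rw [if_neg (Finset.ne_of_mem_erase hj')]]
  simp only [Finset.card_univ, Fintype.card_fun, Fintype.card_bool]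
  ring

/-! ### Truncated block sums -/

/-- The truncation of `x / a` to `[-1, 1]`. -/
noncomputable def truncate (a x : ℝ) : ℝ := max (-1) (min 1 (x / a))

theorem truncate_neg (a x : ℝ) : truncate a (-x) = -truncate a x := by
  rw [truncate, truncate, neg_div]
  rcases le_total 1 (x / a) with h | h <;> rcases le_total (-1) (x / a) with h' | h' <;>
  grind

theorem abs_truncate_le_one (a x : ℝ) : |truncate a x| ≤ 1 := by
  rw [truncate]; grind

theorem abs_truncate_sub_le {a : ℝ} (ha : 0 < a) (x y : ℝ) :
    |truncate a x - truncate a y| ≤ 1 / a * |x - y| := by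
  have h : 1 / a * |x - y| = |x / a - y / a| := by
    rw [← sub_div, abs_div, abs_of_pos ha]; ring
  rw [h, truncate, truncate]
  generalize x / a = u
  generalize y / a = v
  rw [max_comm (-1), max_comm (-1), min_comm 1, min_comm 1]
  exact (abs_max_sub_max_le_abs _ _ _).trans
    (by simpa using abs_min_sub_min_le_max u 1 v 1)

theorem abs_truncate_eq_one {a x : ℝ} (ha : 0 < a) (h : a ≤ |x|) : |truncate a x| = 1 := by
  have h' : 1 ≤ |x / a| := by rwa [abs_div, abs_of_pos ha, one_le_div ha]
  rw [truncate]
  grind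

theorem blockSum_fst {J K : Type*} [Fintype J] [DecidableEq J] [Fintype K]
    (t : J × K → Bool) (j : J) :
    blockSum Prod.fst Finset.univ t j = ∑ k, boolSign (t (j, k)) := by
  rw [blockSum, Finset.sum_filter, Fintype.sum_prod_type]
  rw [Finset.sum_eq_single j] <;> simp +contextual

theorem le_sum_abs_truncate_blockSum {J : Type*} [Fintype J] [DecidableEq J] {r : ℕ} (hr : 0 < r)
    (j : J) :
    3 / 4 * (Fintype.card (J × Fin (64 * r ^ 2) → Bool) : ℝ) ≤
      ∑ t : J × Fin (64 * r ^ 2) → Bool,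
        |truncate (2 * r) (blockSum Prod.fst Finset.univ t j)| := by
  set m := 64 * r ^ 2
  have hr' : (0 : ℝ) < 2 * r := by positivity
  set B := Finset.univ.filter fun t : J × Fin m → Bool => |∑ k, boolSign (t (j, k))| < 2 * r
  have hB : 4 * (B.card : ℝ) ≤ Fintype.card (J × Fin m → Bool) := by
    have h1 := card_filter_marginal (fun s : Fin m → Bool => |∑ k, boolSign (s k)| < 2 * r) j
    rw [Fintype.card_fin] at h1
    have h2 := card_abs_sum_boolSign_lt_le r
    have h3 : 4 * B.card ≤ Fintype.card (J × Fin m → Bool) := by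
      refine Nat.le_of_mul_le_mul_right ?_ (show 0 < 2 ^ m by positivity)
      calc 4 * B.card * 2 ^ m = 4 * (B.card * 2 ^ m) := by ring
        _ = 4 * ((Finset.univ.filter fun s : Fin m → Bool =>
            |∑ k, boolSign (s k)| < 2 * r).card * Fintype.card (J × Fin m → Bool)) := by rw [h1]
        _ ≤ Fintype.card (J × Fin m → Bool) * 2 ^ m := by rw [← mul_assoc, mul_comm]; gcongr
    exact_mod_cast h3
  have hpt : ∀ t : J × Fin m → Bool, 1 - (if t ∈ B then 1 else 0) ≤
      |truncate (2 * r) (blockSum Prod.fst Finset.univ t j)| := by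
    intro t
    split_ifs with ht
    · simp
    · rw [abs_truncate_eq_one hr']
      · simp
      · rw [blockSum_fst]
        simpa [B] using ht
  refine le_trans ?_ (Finset.sum_le_sum fun t _ => hpt t)
  rw [Finset.sum_sub_distrib]
  simp
  simp at hB
  linarith

/-! ### The loss of one pair of rows -/

/-- The projection of `ℝ` onto `[0, 1]`. -/
noncomputable def ramp (x : ℝ) : ℝ := max 0 (min 1 x)

theorem abs_ramp_sub_le (x y : ℝ) : |ramp x - ramp y| ≤ |x - y| := by
  rw [ramp, ramp, max_comm 0, max_comm 0, min_comm 1, min_comm 1]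
  exact (abs_max_sub_max_le_abs _ _ _).trans (by simpa using abs_min_sub_min_le_max x 1 y 1)

theorem ramp_mem_Lip : ramp ∈ Lip 1 :=
  ⟨by simp [ramp], fun x y => by rw [one_mul]; exact abs_ramp_sub_le x y⟩

theorem continuous_ramp : Continuous ramp := by unfold ramp; fun_prop

theorem ramp_nonneg (x : ℝ) : 0 ≤ ramp x := le_max_left _ _

theorem ramp_le_one (x : ℝ) : ramp x ≤ 1 := max_le zero_le_one (min_le_left _ _)

theorem ramp_of_nonpos {x : ℝ} (hx : x ≤ 0) : ramp x = 0 :=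
  max_eq_left ((min_le_right _ _).trans hx)

theorem ramp_of_mem {x : ℝ} (h0 : 0 ≤ x) (h1 : x ≤ 1) : ramp x = x := by
  rw [ramp, min_eq_right h1, max_eq_right h0]

/-- The sign of a real number, with value `1` at `0`. -/
noncomputable def signOne (x : ℝ) : ℝ := if 0 ≤ x then 1 else -1

theorem abs_signOne (x : ℝ) : |signOne x| = 1 := by
  rw [signOne]; split_ifs <;> simp

/-- The point of the opposite sign at which `ramp` has the complementary value. -/
noncomputable def rampFlip (x : ℝ) : ℝ := if 0 ≤ x then ramp x - 1 else 1 - ramp (-x)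

/-- The loss at `x` of the two rows `1` and `-1` with responses `1, 0` or `0, 1`, depending on the
bit `a`. -/
noncomputable def pairLoss (p x : ℝ) (a : Bool) : ℝ :=
  ∑ s : Bool, |ramp (boolSign s * x) - if a = s then 1 else 0| ^ p

theorem pairLoss_zero {p : ℝ} (hp : 0 < p) (a : Bool) : pairLoss p 0 a = 1 := by
  cases a <;> simp [pairLoss, ramp, hp.ne']

/-- One row of the pair always has `ramp` value `0`, so it contributes `0` or `1`; the other
contributes the same term before and after the flip. -/
theorem pairLoss_rampFlip {p : ℝ} (hp : 0 < p) (x : ℝ) (a : Bool) :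
    pairLoss p (rampFlip x) a = pairLoss p x a + signOne x * boolSign a := by
  have h0 := ramp_nonneg x
  have h1 := ramp_le_one x
  have h0' := ramp_nonneg (-x)
  have h1' := ramp_le_one (-x)
  rcases le_or_gt 0 x with hx | hx
  · have e1 : rampFlip x = -(1 - ramp x) := by rw [rampFlip, if_pos hx]; ring
    have e2 : ramp (-x) = 0 := ramp_of_nonpos (by linarith)
    have e3 : ramp (-(1 - ramp x)) = 0 := ramp_of_nonpos (by linarith)
    have e4 : ramp (1 - ramp x) = 1 - ramp x := ramp_of_mem (by linarith) (by linarith)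
    cases a <;>
      simp [pairLoss, boolSign, e1, e2, -neg_sub, e3, e4, signOne, hx, hp.ne',
        abs_sub_comm (1 : ℝ) (ramp x), Real.zero_rpow]
    exact add_comm _ _
  · have e1 : rampFlip x = 1 - ramp (-x) := by rw [rampFlip, if_neg hx.not_ge]
    have e2 : ramp x = 0 := ramp_of_nonpos hx.le
    have e3 : ramp (-(1 - ramp (-x))) = 0 := ramp_of_nonpos (by linarith)
    have e4 : ramp (1 - ramp (-x)) = 1 - ramp (-x) := ramp_of_mem (by linarith) (by linarith)
    cases a <;>
      simp [pairLoss, boolSign, e1, e2, -neg_sub, e3, e4, signOne, hx.not_ge, hp.ne',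
        abs_sub_comm (1 : ℝ) (ramp (-x)), Real.zero_rpow]

/-! ### The hard instance -/

section HardInstance

variable {n d m : ℕ} (e : (Fin d × Fin m) × Bool ↪ Fin n)

/-- The matrix with `m` pairs of rows `1, -1` in every coordinate; all other rows are zero. -/
noncomputable def hardMatrix : Matrix (Fin n) (Fin d) ℝ :=
  Function.extend e (fun r => Pi.single r.1.1 (boolSign r.2)) 0

/-- The responses encoding the bits `t`. -/
noncomputable def hardVector (t : Fin d × Fin m → Bool) : Fin n → ℝ :=
  Function.extend e (fun r => if t r.1 = r.2 then 1 else 0) 0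

theorem hardMatrix_mulVec_apply (x : Fin d → ℝ) (r : (Fin d × Fin m) × Bool) :
    (hardMatrix e).mulVec x (e r) = boolSign r.2 * x r.1.1 := by
  rw [Matrix.mulVec, hardMatrix, e.injective.extend_apply, single_dotProduct]

theorem hardMatrix_mulVec_of_notMem (x : Fin d → ℝ) {i : Fin n} (hi : i ∉ Set.range e) :
    (hardMatrix e).mulVec x i = 0 := by
  rw [Matrix.mulVec, hardMatrix, Function.extend_apply' _ _ _ hi]
  simp

theorem loss_hard {p : ℝ} (hp : 0 < p) (t : Fin d × Fin m → Bool) (x : Fin d → ℝ) :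
    loss p (hardMatrix e) ramp (hardVector e t) x =
      ∑ j, ∑ k, pairLoss p (x j) (t (j, k)) := by
  rw [loss, lpPow]
  trans ∑ r : (Fin d × Fin m) × Bool,
    |ramp (boolSign r.2 * x r.1.1) - if t r.1 = r.2 then 1 else 0| ^ p
  · refine (Fintype.sum_of_injective e e.injective _ _ (fun i hi => ?_) fun r => ?_).symm
    · rw [hardMatrix_mulVec_of_notMem e x hi, hardVector, Function.extend_apply' _ _ _ hi]
      simp [ramp, hp.ne']
    · rw [hardMatrix_mulVec_apply, hardVector, e.injective.extend_apply]
  · rw [Fintype.sum_prod_type, Fintype.sum_prod_type]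
    rfl

theorem lpPow_hardMatrix_mulVec {p : ℝ} (hp : 0 < p) (x : Fin d → ℝ) :
    lpPow p ((hardMatrix e).mulVec x) = 2 * m * ∑ j, |x j| ^ p := by
  rw [lpPow]
  trans ∑ r : (Fin d × Fin m) × Bool, |x r.1.1| ^ p
  · refine (Fintype.sum_of_injective e e.injective _ _ (fun i hi => ?_) fun r => ?_).symm
    · rw [hardMatrix_mulVec_of_notMem e x hi]
      simp [hp.ne']
    · rw [hardMatrix_mulVec_apply, abs_mul]
      cases r.2 <;> simp [boolSign]
  · rw [Fintype.sum_prod_type, Fintype.sum_prod_type, Finset.mul_sum]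
    refine Finset.sum_congr rfl fun j _ => ?_
    simp
    ring

theorem continuous_loss_hard {p : ℝ} (hp : 0 < p) (b : Fin n → ℝ) :
    Continuous (loss p (hardMatrix e) ramp b) := by
  unfold loss lpPow
  refine continuous_finsetSum _ fun i _ => Continuous.rpow_const ?_ fun _ => Or.inr hp.le
  refine ((continuous_ramp.comp ?_).sub continuous_const).abs
  exact (continuous_apply i).comp (Continuous.matrix_mulVec continuous_const continuous_id)

/-- The truncation of a point of `ℝ ^ d` to the cube `[-1, 1] ^ d`. -/
noncomputable def clipCube (x : Fin d → ℝ) : Fin d → ℝ := fun j => max (-1) (min 1 (x j))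

theorem abs_clipCube_apply_le {d : ℕ} (x : Fin d → ℝ) (j : Fin d) : |clipCube x j| ≤ |x j| := by
  rw [clipCube]; grind

theorem loss_hard_clipCube {p : ℝ} (hp : 0 < p) (t : Fin d × Fin m → Bool) (x : Fin d → ℝ) :
    loss p (hardMatrix e) ramp (hardVector e t) (clipCube x) =
      loss p (hardMatrix e) ramp (hardVector e t) x := by
  have h1 : ∀ y : ℝ, ramp (max (-1) (min 1 y)) = ramp y := by intro y; unfold ramp; grind
  have h2 : ∀ y : ℝ, ramp (-max (-1) (min 1 y)) = ramp (-y) := by intro y; unfold ramp; grind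
  simp [loss_hard e hp, pairLoss, boolSign, clipCube, h1, h2]

/-- Without such a point `ErrorGuarantee` would be vacuous. Clipping to the cube keeps the loss and
does not raise the norm, so compactness of the cube suffices. -/
theorem exists_isMinNormMinimizer_hard {p : ℝ} (hp : 0 < p) (t : Fin d × Fin m → Bool) :
    ∃ x, IsMinNormMinimizer p (hardMatrix e) ramp (hardVector e t) x ∧
      lpPow p ((hardMatrix e).mulVec x) ≤ 2 * (d * m) := by
  set F := loss p (hardMatrix e) ramp (hardVector e t) with hF
  have hFc : Continuous F := continuous_loss_hard e hp _
  set I : Set (Fin d → ℝ) := Set.Icc (fun _ => -1) (fun _ => 1) with hI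
  have hclip : ∀ x, clipCube x ∈ I := fun x =>
    ⟨fun j => le_max_left _ _, fun j => max_le (by norm_num) (min_le_left _ _)⟩
  obtain ⟨x₁, -, hmin⟩ := (isCompact_Icc : IsCompact I).exists_isMinOn
    ⟨_, hclip 0⟩ hFc.continuousOn
  have hx₁ : ∀ y, F x₁ ≤ F y := fun y =>
    (hmin (hclip y)).trans_eq (loss_hard_clipCube e hp t y)
  have hN : Continuous fun x => lpPow p ((hardMatrix e).mulVec x) := by
    simp only [lpPow_hardMatrix_mulVec e hp]
    exact continuous_const.mul (continuous_finsetSum _ fun j _ =>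
      ((continuous_apply j).abs).rpow_const fun _ => Or.inr hp.le)
  have hcomp : IsCompact (I ∩ {x | F x ≤ F x₁}) :=
    isCompact_Icc.inter_right (isClosed_le hFc continuous_const)
  obtain ⟨x, ⟨hxI, hx⟩, hxN⟩ := hcomp.exists_isMinOn
    ⟨clipCube x₁, hclip _, (loss_hard_clipCube e hp t x₁).le⟩ hN.continuousOn
  refine ⟨x, ⟨fun y => le_trans hx (hx₁ y), fun y hy => ?_⟩, ?_⟩
  · refine (hxN (a := clipCube y) ⟨hclip y, (loss_hard_clipCube e hp t y).trans_le (hy x₁)⟩).trans ?_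
    change lpPow p ((hardMatrix e).mulVec (clipCube y)) ≤ _
    rw [lpPow_hardMatrix_mulVec e hp, lpPow_hardMatrix_mulVec e hp]
    exact mul_le_mul_of_nonneg_left (Finset.sum_le_sum fun j _ =>
      Real.rpow_le_rpow (abs_nonneg _) (abs_clipCube_apply_le y j) hp.le) (by positivity)
  · rw [lpPow_hardMatrix_mulVec e hp]
    have : ∑ j, |x j| ^ p ≤ ∑ _j : Fin d, (1 : ℝ) := Finset.sum_le_sum fun j _ =>
      Real.rpow_le_one (abs_nonneg _) (abs_le.2 ⟨hxI.1 j, hxI.2 j⟩) hp.le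
    simp only [Finset.sum_const, Finset.card_univ, Fintype.card_fin, nsmul_eq_mul, mul_one] at this
    calc 2 * m * ∑ j, |x j| ^ p ≤ 2 * m * d := by gcongr
      _ = _ := by ring

theorem loss_hard_flip {p : ℝ} (hp : 0 < p) (t : Fin d × Fin m → Bool) (x : Fin d → ℝ) :
    loss p (hardMatrix e) ramp (hardVector e t) (fun j =>
        if signOne (x j) * blockSum Prod.fst Finset.univ t j < 0 then rampFlip (x j) else x j) =
      loss p (hardMatrix e) ramp (hardVector e t) x -
        ∑ j, (|blockSum Prod.fst Finset.univ t j| -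
          signOne (x j) * blockSum Prod.fst Finset.univ t j) / 2 := by
  rw [loss_hard e hp, loss_hard e hp, ← Finset.sum_sub_distrib]
  refine Finset.sum_congr rfl fun j _ => ?_
  have habs : |blockSum Prod.fst Finset.univ t j| =
      |signOne (x j) * blockSum Prod.fst Finset.univ t j| := by
    rw [abs_mul, abs_signOne, one_mul]
  rw [habs]
  split_ifs with h
  · rw [abs_of_neg h, blockSum_fst, Finset.mul_sum]
    simp only [pairLoss_rampFlip hp, Finset.sum_add_distrib]
    ring
  · rw [abs_of_nonneg (not_lt.1 h)]
    ring

/-- An approximate minimizer has the sign of the block sum in most coordinates. -/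
theorem ErrorGuarantee.sum_abs_blockSum_sub_le {p ε : ℝ} (hp : 0 < p) (hε : 0 ≤ ε)
    {t : Fin d × Fin m → Bool} {x : Fin d → ℝ}
    (h : ErrorGuarantee p 1 ε (hardMatrix e) ramp (hardVector e t) x) :
    ∑ j, (|blockSum Prod.fst Finset.univ t j| -
      signOne (x j) * blockSum Prod.fst Finset.univ t j) ≤ 6 * ε * (d * m) := by
  obtain ⟨xs, hxs, hN⟩ := exists_isMinNormMinimizer_hard e hp t
  have h1 := h xs hxs
  have h2 := hxs.1 fun j =>
    if signOne (x j) * blockSum Prod.fst Finset.univ t j < 0 then rampFlip (x j) else x j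
  rw [loss_hard_flip e hp, ← Finset.sum_div] at h2
  -- The optimum is at most the loss `d * m` at `0`. With the norm bound `2 * (d * m)` the allowed
  -- error is `3 * ε * (d * m)`, and the flip gains half of the sum on the left.
  have h3 := hxs.1 0
  have h4 : loss p (hardMatrix e) ramp (hardVector e t) 0 = d * m := by
    simp [loss_hard e hp, pairLoss_zero hp]
  rw [h4] at h3
  rw [Real.one_rpow, one_mul] at h1
  have h5 : ε * (loss p (hardMatrix e) ramp (hardVector e t) xs +
      lpPow p ((hardMatrix e).mulVec xs)) ≤ ε * (3 * (d * m)) := by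
    gcongr; linarith
  linarith

/-- Makes the success event measurable. -/
theorem isClosed_setOf_errorGuarantee_hard {p : ℝ} (hp : 0 < p) (ε : ℝ) (b : Fin n → ℝ) :
    IsClosed {x | ErrorGuarantee p 1 ε (hardMatrix e) ramp b x} := by
  simp only [ErrorGuarantee, Set.ofPred_forall]
  exact isClosed_iInter fun _ => isClosed_iInter fun _ =>
    isClosed_le (continuous_loss_hard e hp b) continuous_const

end HardInstance

/-! ### From success to many queries -/

/-- Each side is `0` if the signs agree and otherwise twice an absolute value, which truncation does
not increase. -/
theorem abs_truncate_sub_signOne_mul_le {a : ℝ} (ha : 0 < a) (x y : ℝ) :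
    |truncate a x| - signOne y * truncate a x ≤ 1 / a * (|x| - signOne y * x) := by
  have h : 1 / a * (|x| - signOne y * x) = |x / a| - signOne y * (x / a) := by
    rw [abs_div, abs_of_pos ha]; ring
  rw [h, truncate, signOne]
  generalize x / a = u
  clear h
  split_ifs <;> grind

/-- The easy half of Yao's principle: some seed outside the null set does at least as well as the
mean. -/
theorem exists_le_sum_indicator {Ω τ : Type*} [MeasurableSpace Ω] [Fintype τ] (P : Measure Ω)
    [IsProbabilityMeasure P] {S : τ → Set Ω} (hS : ∀ t, MeasurableSet (S t)) {c : ℝ}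
    (hc : ∀ t, ENNReal.ofReal c ≤ P (S t)) {G : Ω → Prop} (hG : ∀ᵐ ω ∂P, G ω) :
    ∃ ω, G ω ∧ c * Fintype.card τ ≤ ∑ t, (S t).indicator (1 : Ω → ℝ) ω := by
  have hint : ∀ t, Integrable ((S t).indicator (1 : Ω → ℝ)) P := fun t =>
    (integrable_const (1 : ℝ)).indicator (hS t)
  obtain ⟨ω, hω, h⟩ := exists_notMem_null_integral_le
    (integrable_finsetSum Finset.univ fun t _ => hint t) (ae_iff.1 hG)
  refine ⟨ω, not_not.1 hω, le_trans ?_ h⟩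
  rw [integral_finsetSum _ fun t _ => hint t]
  have : ∀ t, c ≤ ∫ ω, (S t).indicator (1 : Ω → ℝ) ω ∂P := fun t => by
    rw [integral_indicator_one (hS t)]
    exact (ENNReal.ofReal_le_iff_le_toReal (measure_ne_top _ _)).1 (hc t)
  calc c * Fintype.card τ = ∑ _t : τ, c := by simp [mul_comm]
    _ ≤ _ := Finset.sum_le_sum fun t _ => this t

/-- A deterministic algorithm that succeeds on a `4/5` fraction of the hard instances makes
`Ω(d r ^ 2)` queries. -/
theorem QueryTree.le_mul_of_success_hard {n d m r q : ℕ} (hd : 0 < d) (hr : 0 < r)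
    (hm : m = 64 * r ^ 2) (e : (Fin d × Fin m) × Bool ↪ Fin n) {p ε : ℝ} (hp : 0 < p) (hε : 0 ≤ ε)
    (hεr : 4000 * ε * r ≤ 1) (T : QueryTree n d)
    (hq : ∀ t, T.numQueries (hardVector e t) ≤ q)
    (hT : 4 / 5 * (Fintype.card (Fin d × Fin m → Bool) : ℝ) ≤
      ∑ t, {x | ErrorGuarantee p 1 ε (hardMatrix e) ramp (hardVector e t) x}.indicator
        (1 : (Fin d → ℝ) → ℝ) (T.eval (hardVector e t))) :
    (d * r ^ 2 : ℝ) ≤ 4 * q := by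
  set N : ℝ := (Fintype.card (Fin d × Fin m → Bool) : ℝ) with hN
  have hN0 : 0 < N := by rw [hN]; exact_mod_cast Fintype.card_pos
  have hr0 : (0 : ℝ) < r := by exact_mod_cast hr
  have ha : (0 : ℝ) < 2 * r := by positivity
  have hm0 : 0 < m := by rw [hm]; positivity
  have hd0 : (0 : ℝ) < d := by exact_mod_cast hd
  set ind : (Fin d × Fin m → Bool) → ℝ := fun t =>
    {x | ErrorGuarantee p 1 ε (hardMatrix e) ramp (hardVector e t) x}.indicator
      (1 : (Fin d → ℝ) → ℝ) (T.eval (hardVector e t)) with hind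
  set D : (Fin d × Fin m → Bool) → Fin d → ℝ := blockSum Prod.fst Finset.univ with hD
  set s : (Fin d → ℝ) → Fin d → ℝ := fun x j => signOne (x j) with hs
  -- The bit revealed by each row. Rows outside the range of `e` have response `0`, so any default
  -- bit serves.
  set κ : Fin n → Fin d × Fin m :=
    Function.extend e (fun r => r.1) (fun _ => (⟨0, hd⟩, ⟨0, hm0⟩)) with hκ
  have hb : ∀ i (t t' : Fin d × Fin m → Bool), t (κ i) = t' (κ i) →
      hardVector e t i = hardVector e t' i := by
    intro i t t' h
    by_cases hi : i ∈ Set.range e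
    · obtain ⟨r, rfl⟩ := hi
      rw [hκ, e.injective.extend_apply] at h
      rw [hardVector, hardVector, e.injective.extend_apply, e.injective.extend_apply, h]
    · rw [hardVector, hardVector, Function.extend_apply' _ _ _ hi, Function.extend_apply' _ _ _ hi]
  -- With `K = 1 / (2 * r)`, this `μ` makes `K ^ 2 / (4 * μ)` equal to `1 / 10`.
  have hμ : (0 : ℝ) < 5 / 2 * (1 / (2 * r)) ^ 2 := by positivity
  have hupper := T.sum_corr_le Prod.fst κ (hardVector e) hb (truncate_neg (2 * r)) hμ
    (abs_truncate_sub_le ha) s (fun x j => (abs_signOne _).le)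
  have hupper' : ∑ t, ∑ j, s (T.eval (hardVector e t)) j * truncate (2 * r) (D t j) ≤
      N * (d / 10 + 5 / (8 * r ^ 2) * q) := by
    refine hupper.trans ((Finset.sum_le_sum fun t _ => ?_ :
      _ ≤ ∑ _t : Fin d × Fin m → Bool, (d / 10 + 5 / (8 * r ^ 2) * q : ℝ)).trans_eq ?_)
    · have h1 : (T.numQueries (hardVector e t) : ℝ) ≤ q := by exact_mod_cast hq t
      have h2 : 5 / 2 * (1 / (2 * r)) ^ 2 * (T.numQueries (hardVector e t) : ℝ) ≤
          5 / 2 * (1 / (2 * r)) ^ 2 * q := by gcongr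
      rw [Fintype.card_fin]
      refine add_le_add (le_of_eq ?_) (h2.trans_eq ?_)
      · field_simp; norm_num
      · ring
    · rw [Finset.sum_const, Finset.card_univ, nsmul_eq_mul]
  -- On success the loss of correlation is at most `192 * ε * r * d`; on failure it is at most `2`
  -- per coordinate.
  have hpt : ∀ t, ∑ j, |truncate (2 * r) (D t j)| - 48 / 1000 * d - 2 * d * (1 - ind t) ≤
      ∑ j, s (T.eval (hardVector e t)) j * truncate (2 * r) (D t j) := by
    intro t
    set x := T.eval (hardVector e t)
    by_cases hx : ErrorGuarantee p 1 ε (hardMatrix e) ramp (hardVector e t) x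
    · have h1 : ind t = 1 := Set.indicator_of_mem hx _
      have h2 := hx.sum_abs_blockSum_sub_le e hp hε
      have h3 := Finset.sum_le_sum fun j (_ : j ∈ Finset.univ) =>
        abs_truncate_sub_signOne_mul_le ha (D t j) (x j)
      rw [← Finset.mul_sum, Finset.sum_sub_distrib] at h3
      have h4 : 1 / (2 * r) * ∑ j, (|D t j| - signOne (x j) * D t j) ≤ 48 / 1000 * (d : ℝ) := by
        calc _ ≤ 1 / (2 * r) * (6 * ε * (d * m)) := by gcongr
          _ = 48 / 1000 * d * (4000 * ε * r) := by
            rw [hm]; push_cast; field_simp; ring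
          _ ≤ 48 / 1000 * d * 1 := by gcongr
          _ = _ := mul_one _
      rw [h1]
      linarith
    · have h1 : ind t = 0 := Set.indicator_of_notMem hx _
      have h2 : ∀ j, |truncate (2 * r) (D t j)| - 2 ≤ s x j * truncate (2 * r) (D t j) := by
        intro j
        have h3 : |s x j * truncate (2 * r) (D t j)| = |truncate (2 * r) (D t j)| := by
          rw [abs_mul, abs_signOne, one_mul]
        have h4 := neg_abs_le (s x j * truncate (2 * r) (D t j))
        have h5 := abs_truncate_le_one (2 * r) (D t j)
        linarith
      have h3 := Finset.sum_le_sum fun j (_ : j ∈ Finset.univ) => h2 j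
      rw [Finset.sum_sub_distrib] at h3
      simp only [Finset.sum_const, Finset.card_univ, Fintype.card_fin, nsmul_eq_mul] at h3
      rw [h1]
      linarith
  have hlower := Finset.sum_le_sum fun t (_ : t ∈ Finset.univ) => hpt t
  rw [Finset.sum_sub_distrib, Finset.sum_sub_distrib, Finset.sum_comm,
    ← Finset.mul_sum _ fun t => 1 - ind t, Finset.sum_sub_distrib] at hlower
  simp only [Finset.sum_const, Finset.card_univ, nsmul_eq_mul, mul_one] at hlower
  have habs : d * (3 / 4 * N) ≤ ∑ j, ∑ t, |truncate (2 * r) (D t j)| := by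
    calc d * (3 / 4 * N) = ∑ _j : Fin d, 3 / 4 * N := by simp
      _ ≤ _ := Finset.sum_le_sum fun j _ => by
        subst hm; exact le_sum_abs_truncate_blockSum hr j
  have hfail : 2 * d * (N - ∑ t, ind t) ≤ 2 * d * (1 / 5 * N) := by gcongr; linarith
  -- The margin `0.75 - 0.048 - 0.4 - 0.1` exceeds `1 / 5`.
  have hfinal : N * (3 / 4 * d - 48 / 1000 * d - 2 / 5 * d) ≤
      N * (d / 10 + 5 / (8 * r ^ 2) * q) := by
    linarith
  have h := le_of_mul_le_mul_left hfinal hN0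
  have h' : 1 / 5 * (d : ℝ) ≤ 5 * q / (8 * r ^ 2) := by
    rw [← div_mul_eq_mul_div]; linarith
  rw [le_div_iff₀ (by positivity)] at h'
  have hq0 : (0 : ℝ) ≤ q := by positivity
  linarith

theorem theorem2 (p : ℝ) (hp : 1 ≤ p) :
    ∃ ε₀ > (0 : ℝ), ∃ C > (0 : ℝ), ∃ c > (0 : ℝ),
      ∀ ε : ℝ, 0 < ε → ε ≤ ε₀ →
      ∀ n d : ℕ, C * (d * max 1 (Real.log d)) / ε ^ 2 ≤ n →
      ∀ 𝒜 : RandomizedAlgorithm.{u} n d, 𝒜.Succeeds p ε →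
      ∀ q : ℕ, 𝒜.MakesAtMost q → c * d / ε ^ 2 ≤ q := by
  refine ⟨1 / 4000, by norm_num, 1, one_pos, 1 / (4 * 8000 ^ 2), by norm_num, ?_⟩
  intro ε hε hε₀ n d hn 𝒜 hsucc q hq
  have hp0 : 0 < p := by linarith
  rcases Nat.eq_zero_or_pos d with rfl | hd
  · simp
  -- As `ε ≤ 1 / 4000`, `r` is at least `1`, so the floor loses at most a factor `2`; this gives the
  -- `8000` in `c`.
  set r := ⌊1 / (4000 * ε)⌋₊ with hr
  have h1 : 1 ≤ 1 / (4000 * ε) := by rw [le_div_iff₀ (by positivity)]; linarith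
  have hr1 : 1 ≤ r := Nat.one_le_floor_iff _ |>.2 h1
  have hr1' : (1 : ℝ) ≤ r := by exact_mod_cast hr1
  have hrle : (r : ℝ) ≤ 1 / (4000 * ε) := Nat.floor_le (by positivity)
  have hrlt : 1 / (4000 * ε) < r + 1 := Nat.lt_floor_add_one _
  have hεr : 4000 * ε * r ≤ 1 := by
    rw [le_div_iff₀ (by positivity)] at hrle; linarith
  have hrge : 1 / (8000 * ε) ≤ r := by
    have : 1 / (4000 * ε) = 2 * (1 / (8000 * ε)) := by field_simp; norm_num
    linarith
  have hcard : Fintype.card ((Fin d × Fin (64 * r ^ 2)) × Bool) ≤ Fintype.card (Fin n) := by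
    simp only [Fintype.card_prod, Fintype.card_fin, Fintype.card_bool]
    have h2 : (d * (64 * r ^ 2) * 2 : ℝ) ≤ n := by
      refine le_trans ?_ hn
      rw [le_div_iff₀ (by positivity)]
      calc (d * (64 * r ^ 2) * 2 : ℝ) * ε ^ 2 = (d : ℝ) * (128 / 4000 ^ 2 * (4000 * ε * r) ^ 2) := by ring
        _ ≤ (d : ℝ) * (128 / 4000 ^ 2 * 1 ^ 2) := by gcongr
        _ ≤ (d : ℝ) * 1 := by gcongr; norm_num
        _ ≤ 1 * ((d : ℝ) * max 1 (Real.log d)) := by rw [one_mul]; gcongr; exact le_max_left _ _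
    exact_mod_cast h2
  obtain ⟨e⟩ := Function.Embedding.nonempty_of_card_le hcard
  obtain ⟨ω, hω, hsum⟩ := exists_le_sum_indicator 𝒜.P (c := 4 / 5)
    (S := fun t => {ω | ErrorGuarantee p 1 ε (hardMatrix e) ramp (hardVector e t)
      ((𝒜.tree (hardMatrix e) ramp ω).eval (hardVector e t))})
    (fun t => 𝒜.measurable_eval (hardMatrix e) ramp (hardVector e t)
      (isClosed_setOf_errorGuarantee_hard e hp0 ε (hardVector e t)).measurableSet)
    (fun t => by
      convert hsucc (hardMatrix e) ramp ramp_mem_Lip (hardVector e t) using 1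
      rw [ENNReal.ofReal_div_of_pos (by norm_num)]
      simp)
    (ae_all_iff.2 fun t => hq (hardMatrix e) ramp ramp_mem_Lip (hardVector e t))
  have hmain := (𝒜.tree (hardMatrix e) ramp ω).le_mul_of_success_hard hd hr1 rfl e
    hp0 hε.le hεr hω hsum
  calc 1 / (4 * 8000 ^ 2) * d / ε ^ 2 = (d : ℝ) * (1 / (8000 * ε)) ^ 2 / 4 := by field_simp
    _ ≤ (d : ℝ) * r ^ 2 / 4 := by gcongr
    _ ≤ q := by linarith
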